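/- Let $V$ be a vertex operator algebra (over $\mathbb{C}$, $\mathbb{Z}$-graded by weights, with finite-dimensional weight spaces that vanish in sufficiently negative weight), with vacuum $\mathbf 1$ and modes $Y(a,x)=\sum_{k\in\mathbb Z}a_kx^{-k-1}$, and let $n\ge 0$ be an integer. For $a$ homogeneous and $v\in V$ put $$a\circ_n v=\mathrm{Res}_x\frac{(1+x)^{\mathrm{wt}\,a+n}\,Y(a,x)v}{x^{2n+2}},\qquad a*_nv=\sum_{m=0}^n(-1)^m\binom{m+n}{n}\mathrm{Res}_x\frac{(1+x)^{\mathrm{wt}\,a+n}\,Y(a,x)v}{x^{n+m+1}},$$ with $*_n$ extended linearly to all $a\in V$. Let $O_n^\circ(V)$ be the span of all $a\circ_nv$, let $O_n(V)=\{(L(-1)+L(0))v: v\in V\}+O_n^\circ(V)$, and let $A_n(V)=V/O_n(V)$ be the level $n$ Zhu algebra, with the unital associative product induced by $*_n$. Let $u\in V$ be homogeneous with $\mathrm{wt}\,u\ge -n$, and let $V^u=\langle u\rangle^1$ be the span of all $u_{-k_1}\cdots u_{-k_r}\mathbf 1$ with $r\ge 0$ and $k_1,\dots,k_r\ge 1$.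 For $v\in V$ and $r\ge 0$ let $F_r(v)$ be the span of all $u_{-k_1}\cdots u_{-k_m}v$ with $0\le m\le r$ and $k_1,\dots,k_m\ge 1$. Say that $V^u$ has the permutation property on a subset $W\subset V$ if $$u_{-k_1}\cdots u_{-k_m}v-u_{-k_{\sigma(1)}}\cdots u_{-k_{\sigma(m)}}v\in F_{m-1}(v)$$ for all $m\ge 1$, all permutations $\sigma$ of $\{1,\dots,m\}$, all $k_1,\dots,k_m\ge 1$ and all $v\in W$; and that $V^u$ acts strongly on $W$ if, moreover, $a_jw=0$ for all $a\in V^u$, $w\in W$ and $j\ge 0$. Suppose that $V^u$ is a vertex subalgebra of $V$ (that is, it is closed under all products $a_kb$, $k\in\mathbb Z$) and that it has the permutation property on $V^u$. Let $A_n^u$ be the subalgebra of $A_n(V)$ generated by the classes of the elements of $V^u$. Then: (1) $A_n^u$ is generated, as a unital algebra, by the elements $$u_{-2n-1}^{i_{2n+1}}u_{-2n}^{i_{2n}}\cdots u_{-1}^{i_1}\mathbf 1+O_n(V),\qquad i_1,\dots,i_{2n+1}\in\mathbb{Z}_{\ge 0}.$$ (2) If $V^u$ acts strongly on a subset $W\subset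 V$, then for all $v\in W$, $m\ge 0$ and $k_1,\dots,k_m\ge 1$ the vector $u_{-k_1}\cdots u_{-k_m}v$ (such vectors represent the elements of $A_n^u.W$) is congruent modulo $O_n^\circ(V)$ to a linear combination of vectors $u_{-2n-1}^{i_{2n+1}}u_{-2n}^{i_{2n}}\cdots u_{-1}^{i_1}v$ with $i_1,\dots,i_{2n+1}\in\mathbb{Z}_{\ge 0}$. -/

import Mathlib

open scoped VertexOperator

noncomputable section

/-- A vertex operator algebra structure on a complex vector space `V`. The state-field map sends
`a` to `Y(a, x) = ∑ a_k x^{-k-1}`, so that `a_k` is `(Y a)[[k]]`; the truncation condition is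
part of Mathlib's `VertexOperator`. -/
structure VertexOperatorAlgebra (V : Type*) [AddCommGroup V] [Module ℂ V] where
  /-- the state-field map `a ↦ Y(a, x)` -/
  Y : V →ₗ[ℂ] VertexOperator ℂ V
  /-- the vacuum vector `𝟏` -/
  vac : V
  /-- the conformal vector `ω` -/
  conf : V
  /-- the central charge -/
  charge : ℂ
  /-- the weight spaces `V_(d)` -/
  grading : ℤ → Submodule ℂ V
  isInternal : DirectSum.IsInternal grading
  finiteDimensional_grading : ∀ d : ℤ, FiniteDimensional ℂ (grading d)
  grading_bounded_below : ∃ N : ℤ, ∀ d < N, grading d = ⊥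
  vac_mem : vac ∈ grading 0
  conf_mem : conf ∈ grading 2
  /-- `Y(𝟏, x) = id` -/
  vac_mode : ∀ (k : ℤ) (v : V), ((Y vac)[[k]]) v = if k = -1 then v else 0
  /-- `Y(a, x)𝟏` has no singular terms … -/
  creation : ∀ (a : V) (k : ℕ), ((Y a)[[(k : ℤ)]]) vac = 0
  /-- … and has constant term `a` -/
  creation_const : ∀ a : V, ((Y a)[[-1]]) vac = a
  /-- The Jacobi identity, in components. All three sums have only finitely many nonzero terms. -/
  jacobi : ∀ (a b c : V) (p q r : ℤ),
    ∑ᶠ i : ℕ, (Ring.choose p i : ℂ) • ((Y (((Y a)[[r + i]]) b))[[p + q - i]]) c =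
    ∑ᶠ i : ℕ, ((-1 : ℂ) ^ i * (Ring.choose r i : ℂ)) •
      (((Y a)[[p + r - i]]) (((Y b)[[q + i]]) c) -
        (-1 : ℂ) ^ r • ((Y b)[[q + r - i]]) (((Y a)[[p + i]]) c))
  /-- The Virasoro relations for `L(m) = ω_{m+1}`. -/
  virasoro : ∀ (m n : ℤ) (v : V),
    ((Y conf)[[m + 1]]) (((Y conf)[[n + 1]]) v) - ((Y conf)[[n + 1]]) (((Y conf)[[m + 1]]) v) =
      ((m : ℂ) - n) • ((Y conf)[[m + n + 1]]) v +
        (if m + n = 0 then ((m : ℂ) ^ 3 - m) / 12 * charge else 0) • v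
  /-- `L(0) v = d v` for `v ∈ V_(d)` -/
  L_zero : ∀ (d : ℤ), ∀ v ∈ grading d, ((Y conf)[[1]]) v = (d : ℂ) • v
  /-- the `L(-1)`-derivative property `Y(L(-1)a, x) = d/dx Y(a, x)` -/
  L_neg_one_derivative : ∀ (a : V) (k : ℤ) (v : V),
    ((Y (((Y conf)[[0]]) a))[[k]]) v = (-k : ℂ) • ((Y a)[[k - 1]]) v

namespace VertexOperatorAlgebra

variable {V : Type*} [AddCommGroup V] [Module ℂ V] (A : VertexOperatorAlgebra V)

/-- The mode `a_k`. -/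
def mode (a : V) (k : ℤ) : V →ₗ[ℂ] V := (A.Y a)[[k]]

/-- The Virasoro operator `L(m) = ω_{m+1}`. -/
def L (m : ℤ) : V →ₗ[ℂ] V := A.mode A.conf (m + 1)

/-! ### The level `n` Zhu algebra -/

/-- `Res_x (1+x)^{d+n} x^{-s} Y(a, x) v = ∑_{i ≥ 0} binom(d+n, i) a_{i-s} v`; only finitely many
terms are nonzero. -/
def res (n : ℕ) (d s : ℤ) (a v : V) : V :=
  ∑ᶠ i : ℕ, (Ring.choose (d + n) i : ℂ) • A.mode a (i - s) v

/-- The circle product `a ∘_n v` for `a` homogeneous of weight `d`. -/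
def circ (n : ℕ) (d : ℤ) (a v : V) : V := A.res n d (2 * n + 2) a v

/-- `O_n^∘(V)`, the span of all circle products. -/
def Ocirc (n : ℕ) : Submodule ℂ V :=
  Submodule.span ℂ {x | ∃ d : ℤ, ∃ a ∈ A.grading d, ∃ v : V, x = A.circ n d a v}

/-- `O^L(V) = {(L(-1) + L(0))v}`. -/
def OL : Submodule ℂ V := LinearMap.range (A.L (-1) + A.L 0)

/-- `O_n(V) = O^L(V) + O_n^∘(V)`. -/
def O (n : ℕ) : Submodule ℂ V := A.OL ⊔ A.Ocirc n

/-- The vector space `A_n(V) = V / O_n(V)`. -/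
abbrev Zhu (n : ℕ) : Type _ := V ⧸ A.O n

/-- The class `v + O_n(V)` of `v` in `A_n(V)`. -/
def toZhu (n : ℕ) : V →ₗ[ℂ] A.Zhu n := (A.O n).mkQ

/-- The homogeneous component of weight `d` of a vector. -/
def component (d : ℤ) (a : V) : V :=
  letI := A.isInternal.chooseDecomposition
  (DirectSum.decompose A.grading a d : V)

/-- The product `a *_n v` for `a` homogeneous of weight `d`. -/
def starHom (n : ℕ) (d : ℤ) (a v : V) : V :=
  ∑ m ∈ Finset.range (n + 1),
    ((-1 : ℂ) ^ m * ((m + n).choose n : ℂ)) • A.res n d (n + m + 1) a v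

/-- The product `a *_n v` for general `a`, extended linearly from homogeneous vectors. -/
def star (n : ℕ) (a v : V) : V := ∑ᶠ d : ℤ, A.starHom n d (A.component d a) v

/-- A subspace of `A_n(V)` is a subalgebra if it contains the unit `𝟏 + O_n(V)` and is closed under
the product `(a + O_n(V)) (b + O_n(V)) = a *_n b + O_n(V)` of `A_n(V)`. -/
def IsZhuSubalgebra (n : ℕ) (P : Submodule ℂ (A.Zhu n)) : Prop :=
  A.toZhu n A.vac ∈ P ∧
    ∀ a b : V, A.toZhu n a ∈ P → A.toZhu n b ∈ P → A.toZhu n (A.star n a b) ∈ P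

/-- The subalgebra of `A_n(V)` generated by a set: the smallest one containing it. -/
def zhuAdjoin (n : ℕ) (s : Set (A.Zhu n)) : Submodule ℂ (A.Zhu n) :=
  sInf {P | A.IsZhuSubalgebra n P ∧ s ⊆ P}

/-! ### Words in modes, generation, and the permutation property -/

/-- The vector `a⁽¹⁾_{k_1} ⋯ a⁽ʳ⁾_{k_r} v` for the list `[(a⁽¹⁾, k_1), …, (a⁽ʳ⁾, k_r)]`. -/
def word (l : List (V × ℤ)) (v : V) : V := l.foldr (fun p w => A.mode p.1 p.2 w) v

/-- The list only involves modes `a_k` with `a ∈ S` and `k ≤ -K`. -/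
def IsPosWord (S : Set V) (K : ℤ) (l : List (V × ℤ)) : Prop := ∀ p ∈ l, p.1 ∈ S ∧ p.2 ≤ -K

/-- `⟨S⟩^K`, the span of all `a⁽¹⁾_{k_1} ⋯ a⁽ʳ⁾_{k_r} 𝟏` with `a⁽ⁱ⁾ ∈ S` and `k_i ≤ -K`. -/
def posSpan (S : Set V) (K : ℤ) : Submodule ℂ V :=
  Submodule.span ℂ {x | ∃ l : List (V × ℤ), IsPosWord S K l ∧ x = A.word l A.vac}

/-- A vertex subalgebra: a subspace containing the vacuum and closed under all products `a_k b`. -/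
def IsVertexSubalgebra (U : Submodule ℂ V) : Prop :=
  A.vac ∈ U ∧ ∀ a ∈ U, ∀ b ∈ U, ∀ k : ℤ, A.mode a k b ∈ U

/-- `F_r(v)`, the span of all `a⁽¹⁾_{-k_1} ⋯ a⁽ᵐ⁾_{-k_m} v` with `m ≤ r`, `a⁽ⁱ⁾ ∈ S`, `k_i ≥ K`. -/
def F (S : Set V) (K : ℤ) (r : ℕ) (v : V) : Submodule ℂ V :=
  Submodule.span ℂ
    {x | ∃ l : List (V × ℤ), l.length ≤ r ∧ IsPosWord S K l ∧ x = A.word l v}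

/-- The permutation property of `⟨S⟩^K` on `W`: for `m ≥ 1`, `a⁽ⁱ⁾ ∈ S`, `k_i ≥ K` and `v ∈ W`,
permuting the modes in `a⁽¹⁾_{-k_1} ⋯ a⁽ᵐ⁾_{-k_m} v` changes this vector only by an element of
`F_{m-1}(v)`. -/
def PermutationProperty (S : Set V) (K : ℤ) (W : Set V) : Prop :=
  ∀ l l' : List (V × ℤ), l ≠ [] → l.Perm l' → IsPosWord S K l →
    ∀ v ∈ W, A.word l v - A.word l' v ∈ A.F S K (l.length - 1) v

/-- `⟨S⟩^1` acts strongly on `W`: it has the permutation property on `W`, and `a_j w = 0` for all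
`a ∈ ⟨S⟩^1`, `w ∈ W` and `j ≥ 0`. -/
def ActsStrongly (S : Set V) (W : Set V) : Prop :=
  A.PermutationProperty S 1 W ∧
    ∀ a ∈ A.posSpan S 1, ∀ w ∈ W, ∀ j : ℕ, A.mode a j w = 0

/-- The subalgebra `A_n^u` of `A_n(V)` generated by the classes of elements of `V^u = ⟨u⟩^1`. -/
def zhuSub (n : ℕ) (u : V) : Submodule ℂ (A.Zhu n) :=
  A.zhuAdjoin n (A.toZhu n '' (A.posSpan {u} 1 : Set V))

/-- The ordered monomial `u_{-N}^{i_N} ⋯ u_{-2}^{i_2} u_{-1}^{i_1} v`. -/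
def orderedMonomial (u : V) (i : ℕ → ℕ) : ℕ → V → V
  | 0, v => v
  | N + 1, v => (A.mode u (-((N : ℤ) + 1)))^[i (N + 1)] (orderedMonomial u i N v)

end VertexOperatorAlgebra

end

namespace VertexOperatorAlgebra

variable {V : Type*} [AddCommGroup V] [Module ℂ V] (A : VertexOperatorAlgebra V)

/-! ### Weights -/

/-! Both parts are one reduction. If the nonnegative modes of `V^u` kill `v`, then `b ↦ b_{-1} v` on
`V^u` commutes with the modes of `u` (`mode_mode_neg_one`), so a word in these modes applied to `v`
is the image of the same word applied to the vacuum. This moves the argument into `V^u`, which is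
graded by weight even when `v` is not homogeneous. Part (1) is the case `v = 𝟏`, since `O_n^∘(V) ⊆
O_n(V)`.

Induct on the weight of `b`, bounded below, and then on the length of a word. Permuting modes costs
only shorter words of the same weight (`word_mem_of_perm`). If every index is at least `-(2n+1)`,
sort the word into an ordered monomial. Otherwise bring some `u_k` with `k ≤ -(2n+2)` to the front;
modulo `O_n^∘(V)` it is a combination of modes of larger index (`mode_mem_of_forall_lt`), which give
vectors of `V^u` of lower weight. -/

lemma mode_conf_one_of_mem {d : ℤ} {v : V} (hv : v ∈ A.grading d) :
    A.mode A.conf 1 v = (d : ℂ) • v :=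
  A.L_zero d v hv

/-- The projection of `V` onto the weight space of weight `d`. -/
noncomputable def weightProj (d : ℤ) : V →ₗ[ℂ] V :=
  letI := A.isInternal.chooseDecomposition
  (A.grading d).subtype ∘ₗ DirectSum.component ℂ ℤ (fun i => A.grading i) d ∘ₗ
    (DirectSum.decomposeLinearEquiv A.grading).toLinearMap

lemma weightProj_of_mem {d : ℤ} {v : V} (hv : v ∈ A.grading d) : A.weightProj d v = v := by
  let _ := A.isInternal.chooseDecomposition
  exact DirectSum.decompose_of_mem_same A.grading hv

lemma weightProj_of_mem_ne {d e : ℤ} (h : d ≠ e) {v : V} (hv : v ∈ A.grading d) :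
    A.weightProj e v = 0 := by
  let _ := A.isInternal.chooseDecomposition
  exact DirectSum.decompose_of_mem_ne A.grading hv h

lemma weightProj_mem (d : ℤ) (v : V) : A.weightProj d v ∈ A.grading d :=
  Subtype.property _

lemma eq_weightProj_of_forall_ne {d : ℤ} {v : V} (h : ∀ e, e ≠ d → A.weightProj e v = 0) :
    v = A.weightProj d v := by
  classical
  let _ := A.isInternal.chooseDecomposition
  have h' : ∀ e, e ≠ d → DirectSum.decompose A.grading v e = 0 := fun e he =>
    Subtype.ext (h e he)
  conv_lhs => rw [← DirectSum.sum_support_decompose A.grading v]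
  rw [Finset.sum_eq_single d]
  · rfl
  · intro e _ he
    rw [h' e he]; rfl
  · intro hd
    simpa using hd

lemma weightProj_mode_conf_one (d : ℤ) (v : V) :
    A.weightProj d (A.mode A.conf 1 v) = (d : ℂ) • A.weightProj d v := by
  have hv : v ∈ iSup A.grading := by
    rw [A.isInternal.submodule_iSup_eq_top]; trivial
  induction hv using Submodule.iSup_induction' with
  | mem e x hx =>
    rw [A.mode_conf_one_of_mem hx, map_smul]
    by_cases he : e = d
    · rw [he]
    · rw [A.weightProj_of_mem_ne he hx, smul_zero, smul_zero]
  | zero => simp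
  | add x y _ _ hx hy => simp only [map_add, hx, hy, smul_add]

/-- Distinct weights are distinct eigenvalues of `L(0)`, so every other component vanishes. -/
lemma mem_grading_of_mode_conf_one {d : ℤ} {v : V} (hv : A.mode A.conf 1 v = (d : ℂ) • v) :
    v ∈ A.grading d := by
  rw [A.eq_weightProj_of_forall_ne (d := d) (v := v)]
  · exact A.weightProj_mem d v
  · intro e he
    have h := A.weightProj_mode_conf_one e v
    rw [hv, map_smul, ← sub_eq_zero, ← sub_smul, smul_eq_zero, sub_eq_zero] at h
    rcases h with h | h
    · exact absurd (Int.cast_injective h).symm he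
    · exact h

/-- The weight-`d` part of the span of homogeneous vectors is spanned by those of weight `d`. -/
lemma mem_span_inter_grading {s : Set V} (hs : ∀ x ∈ s, ∃ e, x ∈ A.grading e) {d : ℤ} {v : V}
    (hv : v ∈ Submodule.span ℂ s) (hd : v ∈ A.grading d) :
    v ∈ Submodule.span ℂ (s ∩ A.grading d) := by
  rw [← A.weightProj_of_mem hd]
  clear hd
  induction hv using Submodule.span_induction with
  | mem x hx =>
    obtain ⟨e, he⟩ := hs x hx
    by_cases h : e = d
    · subst h
      rw [A.weightProj_of_mem he]
      exact Submodule.subset_span ⟨hx, he⟩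
    · rw [A.weightProj_of_mem_ne h he]
      exact zero_mem _
  | zero => simp
  | add x y _ _ hx hy => rw [map_add]; exact add_mem hx hy
  | smul c x _ hx => rw [map_smul]; exact Submodule.smul_mem _ c hx

/-! ### Consequences of the Jacobi identity -/

/-- The Jacobi identity at `p = 1`, `q = k`, `r = 0`: `binom(1, i)` leaves two terms on the left,
and `binom(0, i)` leaves the commutator on the right. -/
lemma mode_conf_one_mode (a v : V) (k : ℤ) :
    A.mode A.conf 1 (A.mode a k v) - A.mode a k (A.mode A.conf 1 v) =
      A.mode (A.mode A.conf 0 a) (k + 1) v + A.mode (A.mode A.conf 1 a) k v := by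
  have h := A.jacobi A.conf a v 1 k 0
  rw [finsum_eq_sum_of_support_subset (s := Finset.range 2),
    finsum_eq_single _ 0] at h
  · simp [Finset.sum_range_succ] at h
    simp only [mode]
    rw [← h]
    congr 3
    ring_nf
  · intro i hi
    have : Ring.choose (0 : ℂ) i = 0 := Ring.choose_zero_pos ℂ (Nat.pos_of_ne_zero hi)
    simp [this]
  · intro i hi
    by_contra hlt
    apply hi
    have : Ring.choose (1 : ℂ) i = 0 := by
      rw [← Nat.cast_one, Ring.choose_natCast, Nat.choose_eq_zero_of_lt, Nat.cast_zero]
      simpa using hlt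
    simp [this]

lemma mode_mem_grading {d e : ℤ} {a v : V} (ha : a ∈ A.grading d) (hv : v ∈ A.grading e) (k : ℤ) :
    A.mode a k v ∈ A.grading (d + e - k - 1) := by
  apply A.mem_grading_of_mode_conf_one
  have h := A.mode_conf_one_mode a v k
  have h0 : A.mode (A.mode A.conf 0 a) (k + 1) v = (-(k + 1 : ℤ) : ℂ) • A.mode a k v := by
    have := A.L_neg_one_derivative a (k + 1) v
    rw [add_sub_cancel_right] at this
    exact this
  rw [h0, A.mode_conf_one_of_mem ha, A.mode_conf_one_of_mem hv, map_smul, sub_eq_iff_eq_add] at h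
  have h1 : A.mode ((d : ℂ) • a) k v = (d : ℂ) • A.mode a k v := by
    simp [mode]
  rw [h, h1]
  push_cast
  module

/-- If the nonnegative modes of `a` and `b` kill `v`, then `(a_k b)_{-1} v = a_k b_{-1} v`. -/
lemma mode_mode_neg_one {a b v : V} (ha : ∀ j : ℕ, A.mode a j v = 0)
    (hb : ∀ j : ℕ, A.mode b j v = 0) (k : ℤ) :
    A.mode (A.mode a k b) (-1) v = A.mode a k (A.mode b (-1) v) := by
  simp only [mode] at ha hb ⊢
  -- With `p = 0` only `i = 0` survives on the left. On the right every `a_i v` vanishes, and so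
  -- does `b_{i-1} v` for `i ≥ 1`.
  have h := A.jacobi a b v 0 (-1) k
  rw [finsum_eq_single _ 0, finsum_eq_single _ 0] at h
  · have ha0 := ha 0
    simp at h ha0
    rw [ha0] at h
    simpa using h
  · intro i hi
    obtain ⟨j, rfl⟩ := Nat.exists_eq_succ_of_ne_zero hi
    have h1 : (-1 : ℤ) + ((j.succ : ℕ) : ℤ) = j := by push_cast; ring
    have h2 : (0 : ℤ) + ((j.succ : ℕ) : ℤ) = ((j + 1 : ℕ) : ℤ) := by simp
    rw [h1, h2, ha, hb]
    simp
  · intro i hi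
    have : Ring.choose (0 : ℂ) i = 0 := Ring.choose_zero_pos ℂ (Nat.pos_of_ne_zero hi)
    simp [this]

lemma exists_mode_eq_zero (a v : V) : ∃ N : ℤ, ∀ k, N < k → A.mode a k v = 0 :=
  ⟨-1 - HahnSeries.order ((HahnModule.of ℂ).symm (A.Y a v)), fun k hk =>
    VertexOperator.ncoeff_eq_zero_of_lt_order (A.Y a) k v (by omega)⟩

lemma finite_support_smul_mode (a v : V) (s : ℤ) (c : ℕ → ℂ) :
    (Function.support fun i : ℕ => c i • A.mode a (i - s) v).Finite := by
  obtain ⟨N, hN⟩ := A.exists_mode_eq_zero a v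
  refine (Set.finite_Iic (N + s).toNat).subset fun i hi => ?_
  by_contra h
  apply hi
  simp only [Set.mem_Iic, not_le] at h
  change c i • A.mode a (i - s) v = 0
  rw [hN _ (by omega), smul_zero]

/-- The modes of `L(-1)^j a` are multiples of the modes of `a`. -/
lemma exists_mode_eq_smul_mode {d : ℤ} {a : V} (ha : a ∈ A.grading d) (j : ℕ) :
    ∃ b ∈ A.grading (d + j), ∃ c : ℤ → ℂ, (∀ k < 0, c k ≠ 0) ∧
      ∀ k v, A.mode b k v = c k • A.mode a (k - j) v := by
  induction j with
  | zero => exact ⟨a, by simpa using ha, fun _ => 1, fun _ _ => one_ne_zero, by simp⟩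
  | succ j ih =>
    obtain ⟨b, hb, c, hc, hbc⟩ := ih
    refine ⟨A.mode A.conf 0 b, ?_, fun k => -k * c (k - 1), fun k hk => ?_, fun k v => ?_⟩
    · convert A.mode_mem_grading A.conf_mem hb 0 using 2
      push_cast; ring
    · exact mul_ne_zero (neg_ne_zero.2 (Int.cast_ne_zero.2 hk.ne)) (hc _ (by omega))
    · have h := A.L_neg_one_derivative b k v
      change A.mode (A.mode A.conf 0 b) k v = _ • A.mode b (k - 1) v at h
      rw [h, hbc, smul_smul]
      congr 3
      push_cast; ring

/-- Modulo `O_n^∘(V)`, a mode `a_k` with `k ≤ -(2n+2)` is expressed by the modes of `a` of larger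
index. -/
lemma mode_mem_of_forall_lt {n : ℕ} {d : ℤ} {a : V} (ha : a ∈ A.grading d) {M : Submodule ℂ V}
    (hM : A.Ocirc n ≤ M) {k : ℤ} (hk : k ≤ -(2 * n + 2)) (v : V)
    (hv : ∀ l, k < l → A.mode a l v ∈ M) : A.mode a k v ∈ M := by
  -- The series for `b ∘_n v` starts at index `-(2n+2)`; replacing `a` by a `b` proportional to
  -- `L(-1)^j a` shifts the start to `a_k`.
  obtain ⟨j, hj⟩ : ∃ j : ℕ, k = -(2 * n + 2) - j := ⟨(-(2 * n + 2) - k).toNat, by omega⟩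
  obtain ⟨b, hb, c, hc, hbc⟩ := A.exists_mode_eq_smul_mode ha j
  have hcirc : A.circ n (d + j) b v ∈ M :=
    hM (Submodule.subset_span ⟨_, b, hb, v, rfl⟩)
  -- The index `0` is inserted so that the leading term can be split off even if it vanishes.
  rw [circ, res, finsum_eq_sum_of_support_subset _
    (s := insert 0 (A.finite_support_smul_mode b v _ _).toFinset)
      (by rw [Finset.coe_insert, Set.Finite.coe_toFinset]; exact Set.subset_insert _ _),
    ← Finset.add_sum_erase _ _ (Finset.mem_insert_self _ _)] at hcirc
  have hrest := (Submodule.add_mem_iff_left M (Submodule.sum_mem M fun i hi => by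
    rw [hbc]
    refine Submodule.smul_mem _ _ (Submodule.smul_mem _ _ (hv _ ?_))
    have := (Finset.mem_erase.1 hi).1
    omega)).1 hcirc
  -- The leading binomial coefficient is `1` whatever the weight, and the derivative factor is
  -- nonzero at a negative index, so the leading term can be solved for.
  rw [hbc, Ring.choose_zero_right, one_smul,
    Submodule.smul_mem_iff _ (hc _ (by push_cast; omega))] at hrest
  convert hrest using 3
  rw [hj]; push_cast; ring

/-! ### Words in the modes of one vector -/

lemma word_cons (p : V × ℤ) (l : List (V × ℤ)) (v : V) :
    A.word (p :: l) v = A.mode p.1 p.2 (A.word l v) := rfl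

lemma word_append (l l' : List (V × ℤ)) (v : V) :
    A.word (l ++ l') v = A.word l (A.word l' v) := List.foldr_append

lemma word_replicate (a : V) (k : ℤ) (m : ℕ) (v : V) :
    A.word (List.replicate m (a, k)) v = (A.mode a k)^[m] v := by
  induction m with
  | zero => rfl
  | succ m ih =>
    rw [List.replicate_succ, word_cons, ih, Function.iterate_succ_apply']

/-- The list of modes in an ordered monomial. -/
def orderedList (u : V) (i : ℕ → ℕ) : ℕ → List (V × ℤ)
  | 0 => []
  | N + 1 => List.replicate (i (N + 1)) (u, -((N : ℤ) + 1)) ++ orderedList u i N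

lemma word_orderedList (u : V) (i : ℕ → ℕ) (N : ℕ) (v : V) :
    A.word (orderedList u i N) v = A.orderedMonomial u i N v := by
  induction N with
  | zero => rfl
  | succ N ih => rw [orderedList, word_append, ih, word_replicate]; rfl

omit [AddCommGroup V] [Module ℂ V] in
lemma count_orderedList [DecidableEq V] (u : V) (i : ℕ → ℕ) (N : ℕ) (k : ℤ) :
    (orderedList u i N).count (u, k) = if k < 0 ∧ -(N : ℤ) ≤ k then i (-k).toNat else 0 := by
  induction N with
  | zero =>
    rw [if_neg (by push_cast; omega)]; rfl
  | succ N ih =>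
    rw [orderedList, List.count_append, ih, List.count_replicate]
    by_cases hk : k = -((N : ℤ) + 1)
    · subst hk
      rw [if_pos (by simp), if_neg (by omega), if_pos (by push_cast; omega), add_zero]
      congr 1
    · rw [if_neg (by simpa using Ne.symm hk), zero_add]
      refine if_congr ?_ rfl rfl
      push_cast; omega

omit [AddCommGroup V] [Module ℂ V] in
lemma fst_eq_of_mem_orderedList {u : V} {i : ℕ → ℕ} {N : ℕ} {p : V × ℤ}
    (hp : p ∈ orderedList u i N) : p.1 = u ∧ p.2 ≤ -1 := by
  induction N with
  | zero => simp [orderedList] at hp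
  | succ N ih =>
    rw [orderedList, List.mem_append, List.mem_replicate] at hp
    rcases hp with ⟨-, rfl⟩ | hp
    · exact ⟨rfl, by simp⟩
    · exact ih hp

omit [AddCommGroup V] [Module ℂ V] in
lemma isPosWord_orderedList (u : V) (i : ℕ → ℕ) (N : ℕ) :
    IsPosWord {u} 1 (orderedList u i N) :=
  fun _ hp => fst_eq_of_mem_orderedList hp

/-- The exponents are the multiplicities of the modes in the list. -/
lemma exists_perm_orderedList {u : V} {l : List (V × ℤ)} {N : ℕ} (hl : IsPosWord {u} 1 l)
    (hN : ∀ p ∈ l, -(N : ℤ) ≤ p.2) : ∃ i, l.Perm (orderedList u i N) := by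
  classical
  refine ⟨fun k => l.count (u, -(k : ℤ)), List.perm_iff_count.2 fun ⟨a, k⟩ => ?_⟩
  by_cases ha : a = u
  · subst ha
    rw [count_orderedList]
    split_ifs with hk
    · congr 2; omega
    · refine List.count_eq_zero.2 fun hm => hk ⟨?_, hN _ hm⟩
      have := (hl _ hm).2
      simp at this; omega
  · rw [List.count_eq_zero.2 fun hm : (a, k) ∈ l => ha (hl _ hm).1,
      List.count_eq_zero.2 fun hm => ha (fst_eq_of_mem_orderedList hm).1]

variable {A}

lemma word_mem_posSpan {S : Set V} {K : ℤ} {l : List (V × ℤ)} (hl : IsPosWord S K l) :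
    A.word l A.vac ∈ A.posSpan S K :=
  Submodule.subset_span ⟨l, hl, rfl⟩

lemma self_mem_posSpan (u : V) : u ∈ A.posSpan {u} 1 :=
  Submodule.subset_span ⟨[(u, -1)], by simp [IsPosWord], (A.creation_const u).symm⟩

/-- The weight of a word in the modes of a vector of weight `d`. -/
def wordWeight (d : ℤ) (l : List (V × ℤ)) : ℤ := (l.map fun p => d - p.2 - 1).sum

lemma word_mem_grading {d : ℤ} {u : V} (hu : u ∈ A.grading d) {l : List (V × ℤ)}
    (hl : ∀ p ∈ l, p.1 = u) : A.word l A.vac ∈ A.grading (wordWeight d l) := by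
  induction l with
  | nil => exact A.vac_mem
  | cons p l ih =>
    have hp := hl p (by simp)
    rw [word_cons, hp]
    convert A.mode_mem_grading hu (ih fun q hq => hl q (by simp [hq])) p.2 using 2
    simp [wordWeight]; ring

omit [AddCommGroup V] [Module ℂ V] in
lemma wordWeight_perm (d : ℤ) {l l' : List (V × ℤ)} (h : l.Perm l') :
    wordWeight d l = wordWeight d l' := (h.map _).sum_eq

lemma posSpan_inter_grading_mem {d : ℤ} {u : V} (hu : u ∈ A.grading d) {e : ℤ} {b : V}
    (hb : b ∈ A.posSpan {u} 1) (he : b ∈ A.grading e) :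
    b ∈ Submodule.span ℂ
      ({x | ∃ l : List (V × ℤ), IsPosWord {u} 1 l ∧ x = A.word l A.vac} ∩ A.grading e) := by
  refine A.mem_span_inter_grading ?_ hb he
  rintro _ ⟨l, hl, rfl⟩
  exact ⟨_, word_mem_grading hu fun p hp => (hl p hp).1⟩

/-! ### Reduction to ordered monomials modulo `O_n^∘(V)` -/

section Reduction

variable {n : ℕ} {u : V} {d : ℤ} {v : V}

/-- On `V^u`, the map `b ↦ b_{-1} v` intertwines the modes of `u`. -/
lemma mode_word_neg_one (hsub : A.IsVertexSubalgebra (A.posSpan {u} 1))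
    (hv : ∀ a ∈ A.posSpan {u} 1, ∀ j : ℕ, A.mode a j v = 0) {l : List (V × ℤ)}
    (hl : ∀ p ∈ l, p.1 = u) :
    A.word l A.vac ∈ A.posSpan {u} 1 ∧ A.mode (A.word l A.vac) (-1) v = A.word l v := by
  induction l with
  | nil => exact ⟨hsub.1, (A.vac_mode (-1) v).trans (if_pos rfl)⟩
  | cons p l ih =>
    obtain ⟨h1, h2⟩ := ih fun q hq => hl q (by simp [hq])
    have hp := hl p (by simp)
    have hu := self_mem_posSpan (A := A) u
    rw [word_cons, word_cons, ← h2, hp]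
    exact ⟨hsub.2 _ hu _ h1 _, A.mode_mode_neg_one (hv u hu) (hv _ h1) _⟩

/-- The vectors congruent modulo `O_n^∘(V)` to combinations of ordered monomials applied to `v`. -/
def reducible (A : VertexOperatorAlgebra V) (n : ℕ) (u v : V) : Submodule ℂ V :=
  Submodule.span ℂ {y | ∃ i : ℕ → ℕ, y = A.orderedMonomial u i (2 * n + 1) v} ⊔ A.Ocirc n

lemma mode_mem_reducible_of_span {M : Submodule ℂ V} {s : Set V} {b : V}
    (hs : ∀ x ∈ s, A.mode x (-1) v ∈ M) (hb : b ∈ Submodule.span ℂ s) :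
    A.mode b (-1) v ∈ M := by
  have : Submodule.span ℂ s ≤
      M.comap ((LinearMap.applyₗ v) ∘ₗ (LinearMap.proj (-1)) ∘ₗ VertexOperator.ncoeff ∘ₗ A.Y) :=
    Submodule.span_le.2 hs
  exact this hb

lemma mode_sub_mem_iff {M : Submodule ℂ V} {b c : V} (h : A.mode (b - c) (-1) v ∈ M) :
    A.mode b (-1) v ∈ M ↔ A.mode c (-1) v ∈ M := by
  have : A.mode (b - c) (-1) v = A.mode b (-1) v - A.mode c (-1) v := by simp [mode]
  rw [this] at h
  exact ⟨fun hb => by simpa using sub_mem hb h, fun hc => by simpa using add_mem h hc⟩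

/-- Both words have the same weight, so their difference is homogeneous. Projecting the error in
`F_{m-1}(𝟏)` to that weight discards the shorter words of any other weight, which is what keeps the
outer induction on weight usable. -/
lemma word_mem_of_perm (hu : u ∈ A.grading d)
    (hvac : A.vac ∈ A.posSpan {u} 1)
    (hperm : A.PermutationProperty {u} 1 (A.posSpan {u} 1 : Set V)) {M : Submodule ℂ V}
    {l l' : List (V × ℤ)} (hl : IsPosWord {u} 1 l) (hll' : l.Perm l')
    (hM : ∀ t : List (V × ℤ), t.length < l.length → IsPosWord {u} 1 t →
      wordWeight d t = wordWeight d l → A.mode (A.word t A.vac) (-1) v ∈ M)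
    (h' : A.mode (A.word l' A.vac) (-1) v ∈ M) : A.mode (A.word l A.vac) (-1) v ∈ M := by
  by_cases hne : l = []
  · subst hne
    rwa [hll'.nil_eq]
  have hgr := word_mem_grading hu fun p hp => (hl p hp).1
  have hgr' := word_mem_grading hu fun p hp => (hl p (hll'.mem_iff.2 hp)).1
  rw [← wordWeight_perm d hll'] at hgr'
  refine (mode_sub_mem_iff (mode_mem_reducible_of_span ?_ (A.mem_span_inter_grading ?_
    (hperm l l' hne hll' hl A.vac hvac) (sub_mem hgr hgr')))).2 h'
  · rintro _ ⟨⟨t, ht, htp, rfl⟩, htl⟩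
    have htg := word_mem_grading hu fun p hp => (htp p hp).1
    have hpos := List.length_pos_iff.2 hne
    by_cases hw : wordWeight d t = wordWeight d l
    · exact hM t (by omega) htp hw
    -- A word lying in two different weight spaces is zero.
    · rw [← A.weightProj_of_mem htl, A.weightProj_of_mem_ne hw htg]
      simp [mode]
  · rintro _ ⟨t, -, htp, rfl⟩
    exact ⟨_, word_mem_grading hu fun p hp => (htp p hp).1⟩

/-- Words of a given weight are reducible if all vectors of `V^u` of lower weight are. -/
lemma word_mem_reducible_of_lower (hu : u ∈ A.grading d)
    (hsub : A.IsVertexSubalgebra (A.posSpan {u} 1))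
    (hperm : A.PermutationProperty {u} 1 (A.posSpan {u} 1 : Set V))
    (hv : ∀ a ∈ A.posSpan {u} 1, ∀ j : ℕ, A.mode a j v = 0) (l : List (V × ℤ))
    (ih : ∀ f < wordWeight d l, ∀ b ∈ A.posSpan {u} 1, b ∈ A.grading f →
      A.mode b (-1) v ∈ reducible A n u v) (hl : IsPosWord {u} 1 l) :
    A.mode (A.word l A.vac) (-1) v ∈ reducible A n u v := by
  classical
  induction hm : l.length using Nat.strong_induction_on generalizing l with
  | _ m ihm =>
    subst hm
    have hM : ∀ t : List (V × ℤ), t.length < l.length → IsPosWord {u} 1 t →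
        wordWeight d t = wordWeight d l →
        A.mode (A.word t A.vac) (-1) v ∈ reducible A n u v :=
      fun t ht htp hw => ihm _ ht t (by rwa [hw]) htp rfl
    by_cases hlow : ∀ p ∈ l, -((2 * n + 1 : ℕ) : ℤ) ≤ p.2
    · obtain ⟨i, hi⟩ := exists_perm_orderedList hl hlow
      refine word_mem_of_perm hu hsub.1 hperm hl hi hM ?_
      rw [(mode_word_neg_one hsub hv fun p hp => (fst_eq_of_mem_orderedList hp).1).2,
        word_orderedList]
      exact Submodule.mem_sup_left (Submodule.subset_span ⟨i, rfl⟩)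
    · push Not at hlow
      obtain ⟨⟨w, k⟩, hpl, hk⟩ := hlow
      obtain rfl : w = u := (hl _ hpl).1
      have hp := List.perm_cons_erase hpl
      have hfst : ∀ k', ∀ p ∈ (w, k') :: l.erase (w, k), p.1 = w := by
        intro k' p hp'
        rcases List.mem_cons.1 hp' with rfl | hp'
        · rfl
        · exact (hl p (List.mem_of_mem_erase hp')).1
      refine word_mem_of_perm hu hsub.1 hperm hl hp hM ?_
      rw [(mode_word_neg_one hsub hv (hfst k)).2, word_cons]
      -- Raising the index from `k` to `k'` lowers the weight by `k' - k`. Since `k'` may be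
      -- nonnegative, the new word need not be a spanning word of `V^u`; it lies in `V^u` because
      -- `V^u` is closed under all products.
      refine A.mode_mem_of_forall_lt hu le_sup_right (by push_cast at hk; omega) _ fun k' hk' => ?_
      have h := mode_word_neg_one hsub hv (hfst k')
      rw [word_cons (v := v)] at h
      rw [← h.2]
      refine ih _ ?_ _ h.1 (word_mem_grading hu (hfst k'))
      rw [wordWeight_perm d hp]
      simp only [wordWeight, List.map_cons, List.sum_cons]
      omega

/-- If the nonnegative modes of `V^u` kill `v`, then all `b_{-1} v` with `b ∈ V^u` are congruent
modulo `O_n^∘(V)` to combinations of ordered monomials applied to `v`. -/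
theorem mode_neg_one_mem_reducible (hu : u ∈ A.grading d)
    (hsub : A.IsVertexSubalgebra (A.posSpan {u} 1))
    (hperm : A.PermutationProperty {u} 1 (A.posSpan {u} 1 : Set V))
    (hv : ∀ a ∈ A.posSpan {u} 1, ∀ j : ℕ, A.mode a j v = 0) {b : V}
    (hb : b ∈ A.posSpan {u} 1) : A.mode b (-1) v ∈ reducible A n u v := by
  obtain ⟨N, hN⟩ := A.grading_bounded_below
  -- Induction on weight, started below the bound `N`, where the weight spaces vanish.
  have key : ∀ t : ℕ, ∀ e < N + t, ∀ b ∈ A.posSpan {u} 1, b ∈ A.grading e →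
      A.mode b (-1) v ∈ reducible A n u v := by
    intro t
    induction t with
    | zero =>
      intro e he b _ hbe
      rw [hN e (by simpa using he), Submodule.mem_bot] at hbe
      simp [hbe, mode]
    | succ t ih =>
      intro e he b hb hbe
      refine mode_mem_reducible_of_span ?_ (posSpan_inter_grading_mem hu hb hbe)
      rintro _ ⟨⟨l, hl, rfl⟩, hle⟩
      have hgr := word_mem_grading hu fun p hp => (hl p hp).1
      by_cases hw : wordWeight d l = e
      · refine word_mem_reducible_of_lower hu hsub hperm hv l (fun f hf => ih f ?_) hl
        push_cast at he
        omega
      · rw [← A.weightProj_of_mem hle, A.weightProj_of_mem_ne hw hgr]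
        simp [mode]
  refine mode_mem_reducible_of_span ?_ hb
  rintro _ ⟨l, hl, rfl⟩
  exact key (wordWeight d l - N + 1).toNat _ (by omega) _ (word_mem_posSpan hl)
    (word_mem_grading hu fun p hp => (hl p hp).1)

end Reduction

/-! ### Generated subalgebras and the main theorem -/

lemma zhuAdjoin_le {n : ℕ} {s : Set (A.Zhu n)} {P : Submodule ℂ (A.Zhu n)}
    (hP : A.IsZhuSubalgebra n P) (hs : s ⊆ P) : A.zhuAdjoin n s ≤ P :=
  sInf_le ⟨hP, hs⟩

lemma zhuAdjoin_le_zhuAdjoin {n : ℕ} {s t : Set (A.Zhu n)}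
    (h : s ⊆ Submodule.span ℂ t) : A.zhuAdjoin n s ≤ A.zhuAdjoin n t :=
  le_sInf fun _ hP => zhuAdjoin_le hP.1 (h.trans (Submodule.span_le.2 hP.2))

end VertexOperatorAlgebra

open VertexOperatorAlgebra in
theorem mainTheorem5 {V : Type*} [AddCommGroup V] [Module ℂ V] (A : VertexOperatorAlgebra V)
    (n : ℕ) (u : V) (d : ℤ) (hu : u ∈ A.grading d) (hd : -(n : ℤ) ≤ d)
    (hsub : A.IsVertexSubalgebra (A.posSpan {u} 1))
    (hperm : A.PermutationProperty {u} 1 (A.posSpan {u} 1 : Set V)) :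
    A.zhuSub n u =
        A.zhuAdjoin n
          {x | ∃ i : ℕ → ℕ, x = A.toZhu n (A.orderedMonomial u i (2 * n + 1) A.vac)} ∧
      ∀ W : Set V, A.ActsStrongly {u} W →
        ∀ v ∈ W, ∀ k : List ℤ, (∀ j ∈ k, 1 ≤ j) →
          ∃ y ∈ Submodule.span ℂ
              {y | ∃ i : ℕ → ℕ, y = A.orderedMonomial u i (2 * n + 1) v},
            A.word (k.map fun j => (u, -j)) v - y ∈ A.Ocirc n := by
  have hred : ∀ v : V, (∀ a ∈ A.posSpan {u} 1, ∀ j : ℕ, A.mode a j v = 0) →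
      ∀ l : List (V × ℤ), IsPosWord {u} 1 l → A.word l v ∈ reducible A n u v := by
    intro v hv l hl
    rw [← (mode_word_neg_one hsub hv fun p hp => (hl p hp).1).2]
    exact mode_neg_one_mem_reducible hu hsub hperm hv (word_mem_posSpan hl)
  refine ⟨le_antisymm (zhuAdjoin_le_zhuAdjoin ?_) (zhuAdjoin_le_zhuAdjoin ?_), ?_⟩
  · rintro _ ⟨b, hb, rfl⟩
    have hb' : b ∈ reducible A n u A.vac :=
      Submodule.span_le.2 (by
        -- The vacuum is killed by all nonnegative modes, so the reduction applies with `v = 𝟏`.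
        rintro _ ⟨l, hl, rfl⟩
        exact hred A.vac (fun a _ j => A.creation a j) l hl) hb
    obtain ⟨y, hy, z, hz, rfl⟩ := Submodule.mem_sup.1 hb'
    have hz0 : A.toZhu n z = 0 := (Submodule.Quotient.mk_eq_zero _).2 (Submodule.mem_sup_right hz)
    rw [map_add, hz0, add_zero]
    refine Submodule.span_mono ?_ (Submodule.apply_mem_span_image_of_mem_span (A.toZhu n) hy)
    rintro _ ⟨_, ⟨i, rfl⟩, rfl⟩
    exact ⟨i, rfl⟩
  · rintro _ ⟨i, rfl⟩
    rw [← word_orderedList]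
    exact Submodule.subset_span ⟨_, word_mem_posSpan (isPosWord_orderedList u i _), rfl⟩
  · intro W hW v hv k hk
    have hpos : IsPosWord {u} 1 (k.map fun j => (u, -j)) := by
      intro p hp
      obtain ⟨j, hj, rfl⟩ := List.mem_map.1 hp
      exact ⟨rfl, neg_le_neg (hk j hj)⟩
    obtain ⟨y, hy, z, hz, hyz⟩ := Submodule.mem_sup.1 (hred v (fun a ha => hW.2 a ha v hv) _ hpos)
    exact ⟨y, hy, by rwa [← hyz, add_sub_cancel_left]⟩
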